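/- Let $n\ge 1$ and let $X$ be the set of real $(2n+1)\times(n+1)$ matrices $A=(a_{ij})_{0\le i\le 2n,\,0\le j\le n}$ of rank $n+1$ all of whose entries are non-zero, with the topology induced from $\mathbb{R}^{(2n+1)(n+1)}$. For $p=(p_0,\dots,p_{2n})\in(\mathbb{R}^{n+1})^{2n+1}$, $p_i=(p_{i0},\dots,p_{in})$, and $A\in X$ let $G_{(p,A)}:\mathbb{R}^{n+1}\to\mathbb{R}^{2n+1}$ be the generalized distance-squared mapping \[ G_{(p,A)}(x)=\Bigl(\sum_{j=0}^n a_{0j}(x_j-p_{0j})^2,\ \dots,\ \sum_{j=0}^n a_{2n,j}(x_j-p_{2n,j})^2\Bigr). \] A $C^\infty$ mapping $f:\mathbb{R}^{n+1}\to\mathbb{R}^{2n+1}$ is called stable if the set of all $H\circ f\circ h$, where $h$ and $H$ run over the $C^\infty$ diffeomorphisms of $\mathbb{R}^{n+1}$ and of $\mathbb{R}^{2n+1}$ (the $\mathcal{A}$-equivalence class of $f$), is open in $C^\infty(\mathbb{R}^{n+1},\mathbb{R}^{2n+1})$ with the Whitney $C^\infty$ topology, and unstable otherwise. Then for every $A\in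 X$ there exist an open neighbourhood $U_A$ of $A$ in $X$ and a non-empty open set $V\subset(\mathbb{R}^{n+1})^{2n+1}$ such that for every $p\in V$ there exists $B\in U_A$ for which $G_{(p,B)}$ is unstable. -/

import Mathlib

open scoped Manifold ContDiff Topology

noncomputable section

/-- The set `C^∞(E, F)` of smooth maps between real normed spaces.  (This is a `def`, so that it
carries no topology other than the Whitney topology below.) -/
def SmoothMap (E F : Type*) [NormedAddCommGroup E] [NormedSpace ℝ E]
    [NormedAddCommGroup F] [NormedSpace ℝ F] : Type _ :=
  {f : E → F // ContDiff ℝ ∞ f}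

/-- The basic Whitney neighbourhood of `f` given by an order `k` and a function `δ`: all smooth `g`
whose derivatives of order at most `k` differ from those of `f` at each point `x` by less
than `δ x`. -/
def whitneyBall {E F : Type*} [NormedAddCommGroup E] [NormedSpace ℝ E]
    [NormedAddCommGroup F] [NormedSpace ℝ F]
    (f : SmoothMap E F) (k : ℕ) (δ : E → ℝ) : Set (SmoothMap E F) :=
  {g | ∀ x : E, ∀ i ≤ k, ‖iteratedFDeriv ℝ i g.1 x - iteratedFDeriv ℝ i f.1 x‖ < δ x}

/-- The Whitney `C^∞` topology (also called the strong topology) on `C^∞(E, F)`, for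
finite-dimensional `E` and `F`: a set is open iff with each of its points `f` it contains the
basic neighbourhood given by some order `k` and some positive continuous function `δ`. -/
instance whitneyTopology (E F : Type*) [NormedAddCommGroup E] [NormedSpace ℝ E]
    [NormedAddCommGroup F] [NormedSpace ℝ F] : TopologicalSpace (SmoothMap E F) where
  IsOpen U := ∀ f ∈ U, ∃ k : ℕ, ∃ δ : E → ℝ,
    Continuous δ ∧ (∀ x, 0 < δ x) ∧ whitneyBall f k δ ⊆ U
  isOpen_univ := fun _ _ => ⟨0, fun _ => 1, continuous_const, fun _ => one_pos, fun _ _ => trivial⟩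
  isOpen_inter := by
    intro U V hU hV f hf
    obtain ⟨k, δ, hδ, hpos, hsub⟩ := hU f hf.1
    obtain ⟨l, ε, hε, hpos', hsub'⟩ := hV f hf.2
    refine ⟨max k l, fun x => min (δ x) (ε x), hδ.min hε,
      fun x => lt_min (hpos x) (hpos' x), fun g hg => ⟨hsub ?_, hsub' ?_⟩⟩
    · exact fun x i hi => (hg x i (hi.trans (le_max_left _ _))).trans_le (min_le_left _ _)
    · exact fun x i hi => (hg x i (hi.trans (le_max_right _ _))).trans_le (min_le_right _ _)
  isOpen_sUnion := by
    intro S hS f hf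
    obtain ⟨U, hU, hfU⟩ := hf
    obtain ⟨k, δ, hδ, hpos, hsub⟩ := hS U hU f hfU
    exact ⟨k, δ, hδ, hpos, hsub.trans (Set.subset_sUnion_of_mem hU)⟩

/-- `𝒜`-equivalence: `f = H ∘ g ∘ h` with `C^∞` diffeomorphisms `h` of the source and `H` of the
target. -/
def AEquivalent {E F : Type*} [NormedAddCommGroup E] [NormedSpace ℝ E]
    [NormedAddCommGroup F] [NormedSpace ℝ F] (f g : SmoothMap E F) : Prop :=
  ∃ (h : Diffeomorph 𝓘(ℝ, E) 𝓘(ℝ, E) E E ∞) (H : Diffeomorph 𝓘(ℝ, F) 𝓘(ℝ, F) F F ∞),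
    f.1 = H ∘ g.1 ∘ h

/-- A smooth map is stable if its `𝒜`-equivalence class is open in the Whitney topology. -/
def IsStable {E F : Type*} [NormedAddCommGroup E] [NormedSpace ℝ E]
    [NormedAddCommGroup F] [NormedSpace ℝ F] (f : SmoothMap E F) : Prop :=
  IsOpen {g : SmoothMap E F | AEquivalent g f}

/-- The generalized distance-squared mapping `G_{(p, A)} : ℝ^{n+1} → ℝ^{k+1}`, whose `i`-th
component is `x ↦ ∑_j a_{ij} (x_j - p_{ij})²`.  (The sup norms of the coordinate spaces
do not matter: smoothness and the Whitney topology are the same for all norms.) -/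
def genDistSq {n k : ℕ} (p : Fin (k + 1) → Fin (n + 1) → ℝ)
    (A : Matrix (Fin (k + 1)) (Fin (n + 1)) ℝ) :
    SmoothMap (Fin (n + 1) → ℝ) (Fin (k + 1) → ℝ) :=
  ⟨fun x i => ∑ j, A i j * (x j - p i j) ^ 2, by fun_prop⟩

/-- The `(2n+1) × (n+1)` real matrices with non-zero entries and of rank `n+1`. -/
def fullRankMatrices (n : ℕ) : Set (Matrix (Fin (2 * n + 1)) (Fin (n + 1)) ℝ) :=
  {A | (∀ i j, A i j ≠ 0) ∧ A.rank = n + 1}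

end

/-!
A smooth `f : E → F` with `dim F = 2 dim E - 1` has a *degenerate singularity* at `x` if some
`c ≠ 0` lies in the kernel of `df(x)` and some `w ≠ 0` in the dual of `F` annihilates both the image
of `df(x)` and all the vectors `d²f(x)(v, c)`.  In these dimensions this says that `0` is not a regular
value of `(x, c) ↦ df(x) c`, that is, that the singularity is not a Whitney umbrella.

A map with a degenerate singularity is unstable, for two reasons.

* The property is invariant under `𝒜`-equivalence
  (`HasDegenerateSingularity.of_aEquivalent`): in the second derivative of `H ∘ f ∘ h` the terms
  with second derivatives of `H` and `h` are killed by `df(x) c = 0` and by `w ∘ df(x) = 0`.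
* Every Whitney neighbourhood of every smooth map contains a map without degenerate singularities
  (`exists_mem_whitneyBall_not_hasDegenerateSingularity`).  The perturbations are
  `f + ∑ l, ψ l • S l` with constant vectors `S l`, where the `ψ l` are the functions
  `ρ, ρ x₁, …, ρ xₘ` for a positive `ρ` that decays as fast as desired together with its derivatives
  (`exists_pos_contDiff_norm_iteratedFDeriv_smul_lt`).  The differentials of the `ψ l` span the dual of
  `E` everywhere, so transversality for almost all `S` follows from Sard's theorem between spaces of
  the same dimension (`exists_not_hasDegenerateSingularity_add_sum_smul`).

It remains to find degenerate singularities of `genDistSq p B` with `B` close to a given `A` and `p`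
ranging over an open set.  Both derivatives of `genDistSq p B` are explicit, and for
`c = e₀ + e₁` the conditions on `x` and `w` become linear relations between the columns of `B`
(`hasDegenerateSingularity_genDistSq_of_two_columns`).  For a suitable `p₀` they hold for a matrix
`B(p)` that depends continuously on `p` near `p₀` and has `B(p₀) = A`.  For `n ≥ 2` the vector `w` exists
because it has to satisfy only `n + 2 < 2n + 1` linear equations
(`exists_continuousAt_hasDegenerateSingularity`).  For `n = 1` one more condition is left, which is
solved by moving the singular point with `p`; this needs the ratios of the two entries of the
rows of `A` to be distinct, which holds after a small change of `A`
(`exists_continuousAt_hasDegenerateSingularity_plane`).  The argument works inside any prescribed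
neighbourhood of `A` (`exists_isOpen_forall_exists_not_isStable`).
-/

open scoped Manifold ContDiff Topology
open MeasureTheory

/-! ### Rapidly decaying positive functions -/

/-- There are positive smooth functions `ρ` that decay, together with finitely many derivatives, as
fast as any given positive continuous `δ` requires, even after multiplication by a fixed smooth `G`.
The normalization `L (G x) = 1` allows `ρ` to be recovered from `ρ • G` as `L (ρ • G)`, so that only the
series for `ρ • G` has to be estimated. -/
theorem exists_pos_contDiff_norm_iteratedFDeriv_smul_lt {E W : Type*}
    [NormedAddCommGroup E] [NormedSpace ℝ E] [FiniteDimensional ℝ E]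
    [NormedAddCommGroup W] [NormedSpace ℝ W] [CompleteSpace W]
    {G : E → W} (hG : ContDiff ℝ ∞ G) (L : W →L[ℝ] ℝ) (hL : ∀ x, L (G x) = 1)
    (K : ℕ) {δ : E → ℝ} (hδ : Continuous δ) (hpos : ∀ x, 0 < δ x) :
    ∃ ρ : E → ℝ, ContDiff ℝ ∞ ρ ∧ (∀ x, 0 < ρ x) ∧
      ∀ x, ∀ i ≤ K, ‖iteratedFDeriv ℝ i (fun y => ρ y • G y) x‖ < δ x := by
  -- `ρ = ∑ ε j * φ j`, where `φ j` is a bump function that is `1` on the ball of radius `j + 1` and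
  -- vanishes outside the ball of radius `j + 2`.
  let φ : (j : ℕ) → ContDiffBump (0 : E) := fun j =>
    { rIn := j + 1, rOut := j + 2, rIn_pos := by positivity, rIn_lt_rOut := by linarith }
  let u : ℕ → E → W := fun j x => φ j x • G x
  have hu : ∀ j, ContDiff ℝ ∞ (u j) := fun j => (φ j).contDiff.smul hG
  have hus : ∀ j, HasCompactSupport (u j) := fun j => (φ j).hasCompactSupport.smul_right
  have hball : ∀ j x, x ∈ tsupport (u j) → x ∈ Metric.closedBall (0 : E) (j + 2) := by
    intro j x hx
    have := closure_mono (Function.support_smul_subset_left (φ j) G) hx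
    rwa [show closure (Function.support (φ j)) = tsupport (φ j) from rfl,
      (φ j).tsupport_eq] at this
  have hC : ∀ i j, ∃ C, ∀ x, ‖iteratedFDeriv ℝ i (u j) x‖ ≤ C := fun i j =>
    ((hu j).continuous_iteratedFDeriv (by exact_mod_cast le_top)).bounded_above_of_compact_support
      ((hus j).iteratedFDeriv i)
  choose C hC using hC
  have hC0 : ∀ i j, 0 ≤ C i j := fun i j => (norm_nonneg _).trans (hC i j 0)
  have hd : ∀ j : ℕ, ∃ d > 0, ∀ x ∈ Metric.closedBall (0 : E) (j + 2), d ≤ δ x := by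
    intro j
    obtain ⟨z, -, hz⟩ := (isCompact_closedBall (0 : E) ((j : ℝ) + 2)).exists_isMinOn
      ⟨0, Metric.mem_closedBall_self (by positivity)⟩ hδ.continuousOn
    exact ⟨δ z, hpos z, fun x hx => hz hx⟩
  choose d hd0 hd using hd
  -- `M j` bounds the derivatives of order at most `max j K`: the bounds for order at most `j` make the
  -- series smooth, those for order at most `K` make it small.
  let M : ℕ → ℝ := fun j => 1 + ∑ i ∈ Finset.range (max j K + 1), C i j
  have hM : ∀ j, 0 < M j := fun j =>
    add_pos_of_pos_of_nonneg one_pos (Finset.sum_nonneg fun i _ => hC0 i j)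
  have hCM : ∀ i j, i ≤ max j K → C i j ≤ M j := fun i j hi =>
    (Finset.single_le_sum (f := fun i => C i j) (fun i _ => hC0 i j)
      (Finset.mem_range.2 (Nat.lt_succ_of_le hi))).trans (le_add_of_nonneg_left zero_le_one)
  let ε : ℕ → ℝ := fun j => (1 / 2) ^ (j + 2) * min 1 (d j) / M j
  have hε : ∀ j, 0 < ε j := fun j =>
    div_pos (mul_pos (by positivity) (lt_min one_pos (hd0 j))) (hM j)
  let U : ℕ → E → W := fun j x => ε j • u j x
  have hU : ∀ j, ContDiff ℝ ∞ (U j) := fun j => contDiff_const.smul (hu j)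
  have hUd : ∀ i j x, iteratedFDeriv ℝ i (U j) x = ε j • iteratedFDeriv ℝ i (u j) x :=
    fun i j x => iteratedFDeriv_const_smul_apply
      ((hu j).contDiffAt.of_le (by exact_mod_cast le_top))
  have hUb : ∀ i j x, i ≤ max j K →
      ‖iteratedFDeriv ℝ i (U j) x‖ ≤ (1 / 2) ^ (j + 2) * min 1 (d j) := by
    intro i j x hi
    rw [hUd, norm_smul, Real.norm_of_nonneg (hε j).le]
    calc ε j * ‖iteratedFDeriv ℝ i (u j) x‖ ≤ ε j * M j := by
          gcongr
          · exact (hε j).le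
          · exact (hC i j x).trans (hCM i j hi)
      _ = _ := div_mul_cancel₀ _ (hM j).ne'
  have hUb1 : ∀ i j x, i ≤ max j K → ‖iteratedFDeriv ℝ i (U j) x‖ ≤ (1 / 2) ^ (j + 2) :=
    fun i j x hi => (hUb i j x hi).trans
      (mul_le_of_le_one_right (by positivity) (min_le_left _ _))
  have hUbδ : ∀ i j x, i ≤ K → ‖iteratedFDeriv ℝ i (U j) x‖ ≤ (1 / 2) ^ (j + 2) * δ x := by
    intro i j x hi
    by_cases hx : x ∈ tsupport (u j)
    · refine (hUb i j x (hi.trans (le_max_right _ _))).trans ?_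
      gcongr
      exact (min_le_right _ _).trans (hd j x (hball j x hx))
    · have : iteratedFDeriv ℝ i (u j) x = 0 := by
        by_contra h
        exact hx (support_iteratedFDeriv_subset i h)
      rw [hUd, this, smul_zero, norm_zero]
      exact mul_nonneg (by positivity) (hpos x).le
  have hsum : HasSum (fun j : ℕ => (1 / 2 : ℝ) ^ (j + 2)) (1 / 2) := by
    have h := hasSum_geometric_two.mul_right ((1 / 2 : ℝ) ^ 2)
    simp only [← pow_add] at h
    rwa [show (2 : ℝ) * (1 / 2) ^ 2 = 1 / 2 by norm_num] at h
  have hsmooth : ContDiff ℝ ∞ (fun x => ∑' j, U j x) := by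
    refine contDiff_tsum_of_eventually (v := fun _ j => (1 / 2 : ℝ) ^ (j + 2)) (fun j => hU j)
      (fun _ _ => hsum.summable) fun k _ => ?_
    rw [Nat.cofinite_eq_atTop]
    filter_upwards [Filter.eventually_ge_atTop k] with j hj x
    exact hUb1 k j x (hj.trans (le_max_left _ _))
  have hsummable : ∀ x, Summable fun j => U j x := fun x =>
    Summable.of_norm_bounded hsum.summable fun j => by
      simpa using hUb1 0 j x (Nat.zero_le _)
  have hLU : ∀ x, (fun j => L (U j x)) = fun j => ε j * φ j x := by
    intro x
    ext j
    simp [U, u, hL]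
  have hsummable' : ∀ x, Summable fun j => ε j * φ j x := fun x => by
    rw [← hLU]; exact L.summable (hsummable x)
  have hρ : ∀ x, L (∑' j, U j x) = ∑' j, ε j * φ j x := fun x => by
    rw [L.map_tsum (hsummable x), hLU]
  refine ⟨fun x => L (∑' j, U j x), L.contDiff.comp hsmooth, fun x => ?_, fun x i hi => ?_⟩
  · simp only [hρ]
    obtain ⟨j, hj⟩ := exists_nat_ge ‖x‖
    refine (hsummable' x).tsum_pos (fun j => mul_nonneg (hε j).le (φ j).nonneg) j ?_
    rw [(φ j).one_of_mem_closedBall (by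
      simp only [mem_closedBall_zero_iff]; exact hj.trans (by simp [φ])), mul_one]
    exact hε j
  · have heq : (fun y => L (∑' j, U j y) • G y) = fun y => ∑' j, U j y := by
      ext1 y
      rw [hρ, ← (hsummable' y).tsum_smul_const]
      exact tsum_congr fun j => mul_smul _ _ _
    rw [heq, iteratedFDeriv_tsum (N := (K : ℕ∞)) (v := fun _ j => (1 / 2 : ℝ) ^ (j + 2))
      (fun j => (hU j).of_le (by exact_mod_cast le_top)) (fun _ _ => hsum.summable)
      (fun k j x hk => hUb1 k j x ((by exact_mod_cast hk : k ≤ K).trans (le_max_right _ _)))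
      (by exact_mod_cast hi)]
    refine (tsum_of_norm_bounded (hsum.mul_right (δ x)) fun j => hUbδ i j x hi).trans_lt ?_
    linarith [hpos x]

/-! ### The theorem of Sard and degenerate singularities -/

/-- The theorem of Sard for maps between spaces of the same dimension, stated for two different
spaces. -/
theorem addHaar_image_eq_zero_of_not_surjective {D C : Type*}
    [NormedAddCommGroup D] [NormedSpace ℝ D] [FiniteDimensional ℝ D]
    [NormedAddCommGroup C] [NormedSpace ℝ C] [FiniteDimensional ℝ C]
    [MeasurableSpace C] [BorelSpace C] (μ : Measure C) [μ.IsAddHaarMeasure]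
    (hdim : Module.finrank ℝ D = Module.finrank ℝ C)
    {T : D → C} {T' : D → D →L[ℝ] C} {s : Set D} (hT : ∀ z ∈ s, HasFDerivAt T (T' z) z)
    (hs : ∀ z ∈ s, ¬ Function.Surjective (T' z)) : μ (T '' s) = 0 := by
  let e : C ≃L[ℝ] D := ContinuousLinearEquiv.ofFinrankEq hdim.symm
  have him : T '' s = (T ∘ e) '' (e ⁻¹' s) := by
    rw [Set.image_comp, Set.image_preimage_eq _ e.surjective]
  rw [him]
  refine addHaar_image_eq_zero_of_det_fderivWithin_eq_zero μ
    (f' := fun y => (T' (e y)).comp (e : C →L[ℝ] D))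
    (fun y hy => ((hT _ hy).comp y e.hasFDerivAt).hasFDerivWithinAt) fun y hy => ?_
  by_contra h
  refine hs _ hy fun y' => ?_
  have hsurj := LinearMap.range_eq_top.1 ((LinearMap.isUnit_iff_range_eq_top _).1
    ((LinearMap.isUnit_iff_isUnit_det _).2 (isUnit_iff_ne_zero.2 h)))
  obtain ⟨z, hz⟩ := hsurj y'
  exact ⟨e z, hz⟩

section SmoothMaps

variable {E F : Type*} [NormedAddCommGroup E] [NormedSpace ℝ E]
  [NormedAddCommGroup F] [NormedSpace ℝ F]

theorem hasFDerivAt_fderiv {f : E → F} (hf : ContDiff ℝ ∞ f) (x : E) :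
    HasFDerivAt (fderiv ℝ f) (fderiv ℝ (fderiv ℝ f) x) x :=
  ((hf.fderiv_right (m := ∞) le_rfl).differentiable (by simp) x).hasFDerivAt

theorem hasFDerivAt_fderiv_apply {f : E → F} (hf : ContDiff ℝ ∞ f) (x c : E) :
    HasFDerivAt (fun z : E × E => fderiv ℝ f z.1 z.2)
      ((fderiv ℝ f x).comp (ContinuousLinearMap.snd ℝ E E) +
        ((fderiv ℝ (fderiv ℝ f) x).comp (ContinuousLinearMap.fst ℝ E E)).flip c) (x, c) := by
  have h3 : HasFDerivAt (fun z : E × E => fderiv ℝ f z.1)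
      ((fderiv ℝ (fderiv ℝ f) x).comp (ContinuousLinearMap.fst ℝ E E)) (x, c) :=
    HasFDerivAt.comp (x, c) (hasFDerivAt_fderiv hf x) hasFDerivAt_fst
  exact h3.clm_apply hasFDerivAt_snd

theorem hasFDerivAt_fderiv_apply_fst {Q : Type*} [NormedAddCommGroup Q] [NormedSpace ℝ Q]
    {f : E → F} (hf : ContDiff ℝ ∞ f) (z : (E × E) × Q) :
    HasFDerivAt (fun z : (E × E) × Q => fderiv ℝ f z.1.1 z.1.2)
      (((fderiv ℝ f z.1.1).comp (ContinuousLinearMap.snd ℝ E E) +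
        ((fderiv ℝ (fderiv ℝ f) z.1.1).comp (ContinuousLinearMap.fst ℝ E E)).flip z.1.2).comp
          (ContinuousLinearMap.fst ℝ (E × E) Q)) z :=
  HasFDerivAt.comp (g := fun z : E × E => fderiv ℝ f z.1 z.2) z
    (hasFDerivAt_fderiv_apply hf z.1.1 z.1.2) hasFDerivAt_fst

theorem fderiv_add_sum_smul {ι : Type*} [Fintype ι] {f : E → F} (hf : ContDiff ℝ ∞ f)
    {ψ : ι → E → ℝ} (hψ : ∀ l, ContDiff ℝ ∞ (ψ l)) (S : ι → F) (x c : E) :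
    fderiv ℝ (fun y => f y + ∑ l, ψ l y • S l) x c =
      fderiv ℝ f x c + ∑ l, fderiv ℝ (ψ l) x c • S l := by
  have h : HasFDerivAt (fun y => f y + ∑ l, ψ l y • S l)
      (fderiv ℝ f x + ∑ l, (fderiv ℝ (ψ l) x).smulRight (S l)) x :=
    ((hf.differentiable (by simp)) x).hasFDerivAt.add <| HasFDerivAt.fun_sum fun l _ =>
      (((hψ l).differentiable (by simp)) x).hasFDerivAt.smul_const (S l)
  rw [h.fderiv]
  simp

theorem fderiv_fderiv_add_sum_smul {ι : Type*} [Fintype ι] {f : E → F} (hf : ContDiff ℝ ∞ f)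
    {ψ : ι → E → ℝ} (hψ : ∀ l, ContDiff ℝ ∞ (ψ l)) (S : ι → F) (x v c : E) :
    fderiv ℝ (fderiv ℝ (fun y => f y + ∑ l, ψ l y • S l)) x v c =
      fderiv ℝ (fderiv ℝ f) x v c + ∑ l, fderiv ℝ (fderiv ℝ (ψ l)) x v c • S l := by
  have hg : ContDiff ℝ ∞ (fun y => f y + ∑ l, ψ l y • S l) :=
    hf.add <| ContDiff.sum fun l _ => (hψ l).smul contDiff_const
  have h1 := hasFDerivAt_fderiv_apply hg x c
  have h2 := (hasFDerivAt_fderiv_apply hf x c).add <| HasFDerivAt.fun_sum (u := Finset.univ)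
    fun l _ => (hasFDerivAt_fderiv_apply (hψ l) x c).smul_const (S l)
  have h3 := h1.unique (h2.congr_of_eventuallyEq
    (Filter.Eventually.of_forall fun z => fderiv_add_sum_smul hf hψ S z.1 z.2))
  simpa [sum_apply] using DFunLike.congr_fun h3 (v, 0)

/-- `f` has a singular point `x` with a kernel vector `c ≠ 0` such that the vectors `df(x) v` and
`d²f(x)(v, c)` do not span `F`, which is expressed by a functional `w ≠ 0` vanishing on all of them.
If `dim F = 2 dim E - 1`, the singular points without this property are the Whitney umbrellas. -/
def HasDegenerateSingularity (f : E → F) : Prop :=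
  ∃ x c : E, c ≠ 0 ∧ fderiv ℝ f x c = 0 ∧ ∃ w : F →L[ℝ] ℝ, w ≠ 0 ∧
    (∀ v, w (fderiv ℝ f x v) = 0) ∧ ∀ v, w (fderiv ℝ (fderiv ℝ f) x v c) = 0

/-- Parametric transversality: if the differentials of the `ψ l` have no common kernel, then
`f + ∑ l, ψ l • S l` has no degenerate singularity for suitable small `S` (indeed, for almost
every `S`).

On the set `R k` of points `(x, c)` with `dψ k (x) c ≠ 0`, the equation saying that `c` lies in the
kernel of the differential of the perturbed map at `x` can be solved for `S k`.  This gives a map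
`T k : (x, c, (S l)_{l ≠ k}) ↦ (dψ k (x) c, S)` between spaces of the same dimension, and a degenerate
singularity with `c` in `R k` is a critical point of it.  The first component of `T k` accounts for the
scaling of `c`. -/
theorem exists_not_hasDegenerateSingularity_add_sum_smul
    [FiniteDimensional ℝ E] [FiniteDimensional ℝ F]
    (hdim : Module.finrank ℝ F + 1 = 2 * Module.finrank ℝ E)
    {f : E → F} (hf : ContDiff ℝ ∞ f) {r : ℕ} {ψ : Fin (r + 1) → E → ℝ}
    (hψ : ∀ l, ContDiff ℝ ∞ (ψ l)) (hinj : ∀ x c, c ≠ 0 → ∃ l, fderiv ℝ (ψ l) x c ≠ 0) :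
    ∃ S : Fin (r + 1) → F, (∀ l, ‖S l‖ < 1) ∧
      ¬ HasDegenerateSingularity (fun y => f y + ∑ l, ψ l y • S l) := by
  borelize F
  let T : Fin (r + 1) → (E × E) × (Fin r → F) → ℝ × (Fin (r + 1) → F) := fun k z =>
    (fderiv ℝ (ψ k) z.1.1 z.1.2, Fin.insertNth k
      (-(fderiv ℝ (ψ k) z.1.1 z.1.2)⁻¹ • (fderiv ℝ f z.1.1 z.1.2 +
        ∑ l, fderiv ℝ (ψ (k.succAbove l)) z.1.1 z.1.2 • z.2 l)) z.2)
  let R : Fin (r + 1) → Set ((E × E) × (Fin r → F)) := fun k =>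
    {z | fderiv ℝ (ψ k) z.1.1 z.1.2 ≠ 0}
  have hdψ : ∀ l, Differentiable ℝ
      (fun z : (E × E) × (Fin r → F) => fderiv ℝ (ψ l) z.1.1 z.1.2) := fun l z =>
    (hasFDerivAt_fderiv_apply_fst (hψ l) z).differentiableAt
  have hdf : Differentiable ℝ
      (fun z : (E × E) × (Fin r → F) => fderiv ℝ f z.1.1 z.1.2) := fun z =>
    (hasFDerivAt_fderiv_apply_fst hf z).differentiableAt
  have hT : ∀ k, ∀ z ∈ R k, HasFDerivAt (T k) (fderiv ℝ (T k) z) z := by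
    intro k z hz
    refine DifferentiableAt.hasFDerivAt ((hdψ k z).prodMk (differentiableAt_pi.2 fun l => ?_))
    have hq : ∀ l, DifferentiableAt ℝ (fun z : (E × E) × (Fin r → F) => z.2 l) z := fun l => by
      fun_prop
    rcases Fin.eq_self_or_eq_succAbove k l with rfl | ⟨l, rfl⟩
    · simp only [Fin.insertNth_apply_same]
      exact ((hdψ _ z).inv hz).neg.smul
        ((hdf z).add (DifferentiableAt.fun_sum fun l _ => (hdψ _ z).smul (hq l)))
    · simpa only [Fin.insertNth_apply_succAbove] using hq l
  have hopen : ∀ k, IsOpen (R k) := fun k => isOpen_ne_fun (hdψ k).continuous continuous_const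
  have hzero : ∀ k, ∀ z ∈ R k, fderiv ℝ f z.1.1 z.1.2 +
      ∑ l, fderiv ℝ (ψ l) z.1.1 z.1.2 • (T k z).2 l = 0 := by
    intro k z hz
    rw [Fin.sum_univ_succAbove _ k]
    simp only [T, Fin.insertNth_apply_same, Fin.insertNth_apply_succAbove]
    rw [smul_smul, mul_neg, mul_inv_cancel₀ hz]
    module
  let N : Fin (r + 1) → Set (ℝ × (Fin (r + 1) → F)) := fun k =>
    T k '' {z ∈ R k | ¬ Function.Surjective (fderiv ℝ (T k) z)}
  let μ : Measure (ℝ × (Fin (r + 1) → F)) := Measure.addHaar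
  have hN : μ (⋃ k, N k) = 0 := by
    refine measure_iUnion_null fun k => addHaar_image_eq_zero_of_not_surjective μ ?_
      (fun z hz => hT k z hz.1) fun z hz => hz.2
    simp only [Module.finrank_prod, Module.finrank_pi_fintype, Module.finrank_self,
      Finset.sum_const, Finset.card_univ, Fintype.card_fin, smul_eq_mul]
    linarith
  -- The first coordinate `t` only has to be non-zero: by homogeneity in `c`, a regular value `(t, S)`
  -- excludes degenerate singularities for all kernel vectors in `R k`.
  obtain ⟨⟨t, S⟩, ⟨ht, hS⟩, htS⟩ : (({0}ᶜ ×ˢ Metric.ball 0 1) \ ⋃ k, N k).Nonempty := by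
    rw [Set.sdiff_nonempty]
    intro hsub
    refine (IsOpen.measure_pos μ (isOpen_compl_singleton.prod Metric.isOpen_ball)
      ⟨((1 : ℝ), (0 : Fin (r + 1) → F)), by simp⟩).ne' (measure_mono_null hsub hN)
  refine ⟨S, fun l => (norm_le_pi_norm S l).trans_lt (by simpa using hS), ?_⟩
  rintro ⟨x, c, hc, hxc, w, hw, hw1, hw2⟩
  obtain ⟨k, hk⟩ := hinj x c hc
  set a : ℝ := t / fderiv ℝ (ψ k) x c with ha
  let z : (E × E) × (Fin r → F) := ((x, a • c), fun l => S (k.succAbove l))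
  have hzt : fderiv ℝ (ψ k) x (a • c) = t := by
    rw [map_smul, smul_eq_mul, ha, div_mul_cancel₀ _ hk]
  have hzR : z ∈ R k := by
    change fderiv ℝ (ψ k) x (a • c) ≠ 0
    rwa [hzt]
  have hTz : T k z = (t, S) := by
    refine Prod.ext hzt (Fin.insertNth_eq_iff.2 ⟨?_, rfl⟩)
    have h := fderiv_add_sum_smul hf hψ S x (a • c)
    rw [map_smul, hxc, smul_zero, Fin.sum_univ_succAbove _ k, hzt] at h
    change -(fderiv ℝ (ψ k) x (a • c))⁻¹ • (fderiv ℝ f x (a • c) +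
        ∑ l, fderiv ℝ (ψ (k.succAbove l)) x (a • c) • S (k.succAbove l)) = S k
    rw [hzt, show fderiv ℝ f x (a • c) +
        ∑ l, fderiv ℝ (ψ (k.succAbove l)) x (a • c) • S (k.succAbove l) = -(t • S k) by
      rw [eq_neg_iff_add_eq_zero, h]; abel, smul_neg, neg_smul, neg_neg, smul_smul,
      inv_mul_cancel₀ ht, one_smul]
  have hsurj : Function.Surjective (fderiv ℝ (T k) z) := by
    by_contra h
    exact htS (Set.mem_iUnion.2 ⟨k, z, ⟨hzR, h⟩, hTz⟩)
  refine hw (ContinuousLinearMap.ext fun y => ?_)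
  -- A tangent vector `ζ` along which only `S k` moves, with velocity chosen so that the derivative of the
  -- identity `hzero` along `ζ` reads `d²g(x)(v, a c) + dg(x) c' = y` for the perturbed map `g`.
  obtain ⟨ζ, hζ⟩ := hsurj (0, Pi.single k (-(t⁻¹ • y)))
  have hS' : ∀ l, HasFDerivAt (fun z => (T k z).2 l) _ z := fun l =>
    hasFDerivAt_pi'.1 (hT k z hzR).snd l
  have hD := ((hasFDerivAt_fderiv_apply_fst hf z).add <|
    HasFDerivAt.fun_sum (u := Finset.univ) fun l _ =>
      (hasFDerivAt_fderiv_apply_fst (hψ l) z).smul (hS' l)).unique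
    ((hasFDerivAt_const (0 : F) z).congr_of_eventuallyEq (by
      filter_upwards [(hopen k).mem_nhds hzR] with z' hz' using hzero k z' hz'))
  have hDζ := DFunLike.congr_fun hD ζ
  have h2 := fderiv_fderiv_add_sum_smul hf hψ S x ζ.1.1 (a • c)
  have h1 := fderiv_add_sum_smul hf hψ S x ζ.1.2
  have key : fderiv ℝ (fderiv ℝ (fun y => f y + ∑ l, ψ l y • S l)) x ζ.1.1 (a • c) +
      fderiv ℝ (fun y => f y + ∑ l, ψ l y • S l) x ζ.1.2 = y := by
    have hy : ∑ l, fderiv ℝ (ψ l) x (a • c) •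
        (Pi.single k (-(t⁻¹ • y)) : Fin (r + 1) → F) l = -y := by
      rw [Finset.sum_eq_single k (fun l _ hl => by rw [Pi.single_eq_of_ne hl, smul_zero])
        (by simp), hzt, Pi.single_eq_same, smul_neg, smul_smul, mul_inv_cancel₀ ht, one_smul]
    simp only [sum_apply, add_apply, smul_apply, ContinuousLinearMap.comp_apply,
      ContinuousLinearMap.flip_apply, ContinuousLinearMap.smulRight_apply,
      ContinuousLinearMap.coe_fst', ContinuousLinearMap.coe_snd', ContinuousLinearMap.proj_apply,
      hTz, hζ, add_smul, Finset.sum_add_distrib, zero_apply] at hDζ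
    rw [hy] at hDζ
    rw [h1, h2, ← sub_eq_zero, ← hDζ]
    abel
  rw [← key, map_add, hw1, map_smul, map_smul, hw2]
  simp

end SmoothMaps

/-! ### Invariance under `𝒜`-equivalence -/

section SmoothMaps

variable {E F : Type*} [NormedAddCommGroup E] [NormedSpace ℝ E]
  [NormedAddCommGroup F] [NormedSpace ℝ F]

theorem fderiv_apply_fderiv_apply_of_leftInverse {h h' : E → E} (hh : Differentiable ℝ h)
    (hh' : Differentiable ℝ h') (hinv : Function.LeftInverse h' h) (x c : E) :
    fderiv ℝ h' (h x) (fderiv ℝ h x c) = c := by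
  have h1 := ((hh' (h x)).hasFDerivAt.comp x (hh x).hasFDerivAt).unique
    ((hasFDerivAt_id x).congr_of_eventuallyEq (Filter.Eventually.of_forall hinv))
  exact DFunLike.congr_fun h1 c

theorem HasDegenerateSingularity.of_aEquivalent {f g : SmoothMap E F} (hgf : AEquivalent g f)
    (hf : HasDegenerateSingularity f.1) : HasDegenerateSingularity g.1 := by
  obtain ⟨h, H, hg⟩ := hgf
  obtain ⟨x, c, hc, hxc, w, hw, hw1, hw2⟩ := hf
  have hh : ContDiff ℝ ∞ h := h.contMDiff.contDiff
  have hh' : ContDiff ℝ ∞ h.symm := h.symm.contMDiff.contDiff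
  have hH : ContDiff ℝ ∞ H := H.contMDiff.contDiff
  have hH' : ContDiff ℝ ∞ H.symm := H.symm.contMDiff.contDiff
  have dh := hh.differentiable (by simp)
  have dh' := hh'.differentiable (by simp)
  have dH := hH.differentiable (by simp)
  have dH' := hH'.differentiable (by simp)
  have df := f.2.differentiable (by simp)
  have hchain : ∀ y v, fderiv ℝ g.1 y v =
      fderiv ℝ H (f.1 (h y)) (fderiv ℝ f.1 (h y) (fderiv ℝ h y v)) := by
    intro y v
    rw [hg]
    rw [((dH _).hasFDerivAt.comp y ((df _).hasFDerivAt.comp y (dh y).hasFDerivAt)).fderiv]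
    rfl
  set z := h.symm x with hz
  have hzx : h z = x := h.apply_symm_apply x
  set b := fderiv ℝ h.symm x c with hb
  have hbc : fderiv ℝ h z b = c :=
    fderiv_apply_fderiv_apply_of_leftInverse dh' dh h.apply_symm_apply x c
  have hHinv : ∀ y, fderiv ℝ H.symm (H (f.1 x)) (fderiv ℝ H (f.1 x) y) = y :=
    fderiv_apply_fderiv_apply_of_leftInverse dH dH' H.symm_apply_apply _
  refine ⟨z, b, ?_, ?_, w.comp (fderiv ℝ H.symm (H (f.1 x))), ?_, ?_, ?_⟩
  · rintro h0
    exact hc (by rw [← hbc, h0, map_zero])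
  · rw [hchain, hzx, hbc, hxc, map_zero]
  · intro h0
    refine hw (ContinuousLinearMap.ext fun y => ?_)
    simpa [hHinv] using DFunLike.congr_fun h0 (fderiv ℝ H (f.1 x) y)
  · intro v
    rw [hchain, hzx, ContinuousLinearMap.comp_apply, hHinv, hw1]
  · intro v
    have hA := (hasFDerivAt_fderiv hh z).clm_apply (hasFDerivAt_const b z)
    have hfh : HasFDerivAt (fun y => fderiv ℝ f.1 (h y)) _ z :=
      (hasFDerivAt_fderiv f.2 (h z)).comp z (dh z).hasFDerivAt
    have hHfh : HasFDerivAt (fun y => fderiv ℝ H (f.1 (h y))) _ z :=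
      (hasFDerivAt_fderiv hH (f.1 (h z))).comp z ((df (h z)).hasFDerivAt.comp z (dh z).hasFDerivAt)
    have hC := hHfh.clm_apply (hfh.clm_apply hA)
    have hG := ((hasFDerivAt_fderiv g.2 z).clm_apply (hasFDerivAt_const b z)).unique
      (hC.congr_of_eventuallyEq (Filter.Eventually.of_forall fun y => hchain y b))
    have hGv := DFunLike.congr_fun hG v
    simp [hzx, hbc, hxc] at hGv
    rw [hGv]
    simp [hHinv, hw1, hw2]

end SmoothMaps

/-! ### Maps with degenerate singularities are unstable -/

theorem exists_mem_whitneyBall_not_hasDegenerateSingularity {m : ℕ} {F : Type*}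
    [NormedAddCommGroup F] [NormedSpace ℝ F] [FiniteDimensional ℝ F]
    (hdim : Module.finrank ℝ F + 1 = 2 * m) (f : SmoothMap (Fin m → ℝ) F) (K : ℕ)
    {δ : (Fin m → ℝ) → ℝ} (hδ : Continuous δ) (hpos : ∀ x, 0 < δ x) :
    ∃ g ∈ whitneyBall f K δ, ¬ HasDegenerateSingularity g.1 := by
  -- `ρ • G = (ρ, ρ x₁, …, ρ xₘ)` has injective differentials: if `dρ(x) c = 0`, then the other
  -- components have the derivatives `ρ(x) c j`.
  let G : (Fin m → ℝ) → Fin (m + 1) → ℝ := fun x => Fin.cons 1 x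
  have hG : ContDiff ℝ ∞ G := contDiff_pi.2 fun l => by
    refine Fin.cases ?_ (fun j => ?_) l
    · exact contDiff_const
    · exact contDiff_apply ℝ ℝ j
  obtain ⟨ρ, hρ, hρ0, hρδ⟩ := exists_pos_contDiff_norm_iteratedFDeriv_smul_lt hG
    (ContinuousLinearMap.proj 0) (fun _ => rfl) K
    (δ := fun x => δ x / (m + 1)) (hδ.div_const _) (fun x => div_pos (hpos x) (by positivity))
  let ψ : Fin (m + 1) → (Fin m → ℝ) → ℝ := fun l x => ρ x • G x l
  have hψ : ∀ l, ContDiff ℝ ∞ (ψ l) := fun l => hρ.smul ((contDiff_pi.1 hG) l)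
  obtain ⟨S, hS, hg⟩ := exists_not_hasDegenerateSingularity_add_sum_smul
    (by simpa using hdim) f.2 hψ (by
    intro x c hc
    by_contra! h
    have dρ := (hρ.differentiable (by simp) x).hasFDerivAt
    have h0 : fderiv ℝ ρ x c = 0 := by
      have := h 0
      rwa [show ψ 0 = ρ by ext y; simp [ψ, G]] at this
    refine hc (funext fun j => ?_)
    have h1 := h j.succ
    have h2 : HasFDerivAt (ψ j.succ) _ x := dρ.mul (hasFDerivAt_apply (𝕜 := ℝ) j x)
    rw [h2.fderiv] at h1
    simpa [h0, (hρ0 x).ne'] using h1)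
  refine ⟨⟨_, f.2.add <| ContDiff.sum fun l _ => (hψ l).smul contDiff_const⟩, ?_, hg⟩
  intro x i hi
  let Λ : (Fin (m + 1) → ℝ) →L[ℝ] F := ∑ l, (ContinuousLinearMap.proj l).smulRight (S l)
  have hΛ : ‖Λ‖ ≤ m + 1 := by
    refine ContinuousLinearMap.opNorm_le_bound _ (by positivity) fun y => ?_
    calc ‖Λ y‖ = ‖∑ l, y l • S l‖ := by simp [Λ]
      _ ≤ ∑ l : Fin (m + 1), ‖y‖ * 1 := by
        refine norm_sum_le_of_le _ fun l _ => ?_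
        rw [norm_smul]
        gcongr
        · exact norm_le_pi_norm y l
        · exact (hS l).le
      _ = (m + 1) * ‖y‖ := by simp
  have hρG : ContDiff ℝ ∞ (fun y => ρ y • G y) := hρ.smul hG
  have heq : (fun y => ∑ l, ψ l y • S l) = Λ ∘ fun y => ρ y • G y := by
    ext1 y
    simp [Λ, ψ, Finset.smul_sum, smul_smul]
  have hle : ∀ {n : ℕ}, (n : WithTop ℕ∞) ≤ ∞ := by exact_mod_cast le_top
  change ‖iteratedFDeriv ℝ i (fun y => f.1 y + ∑ l, ψ l y • S l) x - _‖ < _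
  rw [fun_iteratedFDeriv_add_apply (f.2.contDiffAt.of_le hle)
    ((heq ▸ Λ.contDiff.comp hρG : ContDiff ℝ ∞ fun y => ∑ l, ψ l y • S l).contDiffAt.of_le hle),
    add_sub_cancel_left, heq]
  calc _ ≤ ‖Λ‖ * ‖iteratedFDeriv ℝ i (fun y => ρ y • G y) x‖ :=
        Λ.norm_iteratedFDeriv_comp_left (hρG.contDiffAt.of_le hle) le_rfl
    _ ≤ (m + 1) * ‖iteratedFDeriv ℝ i (fun y => ρ y • G y) x‖ := by gcongr
    _ < δ x := by
      rw [mul_comm, ← lt_div_iff₀ (by positivity)]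
      exact hρδ x i hi

theorem not_isStable_of_hasDegenerateSingularity {m : ℕ} {F : Type*}
    [NormedAddCommGroup F] [NormedSpace ℝ F] [FiniteDimensional ℝ F]
    (hdim : Module.finrank ℝ F + 1 = 2 * m) {f : SmoothMap (Fin m → ℝ) F}
    (hf : HasDegenerateSingularity f.1) : ¬ IsStable f := by
  intro hst
  obtain ⟨K, δ, hδ, hpos, hsub⟩ := hst f
    ⟨Diffeomorph.refl _ _ _, Diffeomorph.refl _ _ _, rfl⟩
  obtain ⟨g, hg, hgd⟩ := exists_mem_whitneyBall_not_hasDegenerateSingularity hdim f K hδ hpos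
  exact hgd (hf.of_aEquivalent (hsub hg))

/-! ### Degenerate singularities of generalized distance-squared mappings -/

theorem fderiv_genDistSq {n k : ℕ} (p : Fin (k + 1) → Fin (n + 1) → ℝ)
    (A : Matrix (Fin (k + 1)) (Fin (n + 1)) ℝ) (x v : Fin (n + 1) → ℝ) (i : Fin (k + 1)) :
    fderiv ℝ (genDistSq p A).1 x v i = 2 * ∑ j, A i j * (x j - p i j) * v j := by
  have h : HasFDerivAt (genDistSq p A).1 (ContinuousLinearMap.pi fun i =>
      ∑ j, A i j • ((2 * (x j - p i j)) •
        ContinuousLinearMap.proj (R := ℝ) (φ := fun _ => ℝ) j)) x := by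
    refine hasFDerivAt_pi.2 fun i => ?_
    change HasFDerivAt (fun y : Fin (n + 1) → ℝ => ∑ j, A i j * (y j - p i j) ^ 2) _ x
    refine HasFDerivAt.fun_sum fun j _ => ?_
    have hj : HasFDerivAt (fun y : Fin (n + 1) → ℝ => y j - p i j)
        (ContinuousLinearMap.proj (R := ℝ) (φ := fun _ => ℝ) j) x :=
      (hasFDerivAt_apply j x).sub_const _
    simpa using (hj.pow 2).const_mul (A i j)
  rw [h.fderiv, Finset.mul_sum]
  simp only [ContinuousLinearMap.pi_apply, sum_apply, smul_apply, ContinuousLinearMap.proj_apply,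
    smul_eq_mul]
  exact Finset.sum_congr rfl fun j _ => by ring

theorem fderiv_fderiv_genDistSq {n k : ℕ} (p : Fin (k + 1) → Fin (n + 1) → ℝ)
    (A : Matrix (Fin (k + 1)) (Fin (n + 1)) ℝ) (x v c : Fin (n + 1) → ℝ) (i : Fin (k + 1)) :
    fderiv ℝ (fderiv ℝ (genDistSq p A).1) x v c i = 2 * ∑ j, A i j * v j * c j := by
  have h1 := (hasFDerivAt_fderiv (genDistSq p A).2 x).clm_apply (hasFDerivAt_const c x)
  have h2 := hasFDerivAt_pi'.1 h1 i
  have h3 : HasFDerivAt (fun y => 2 * ∑ j, A i j * (y j - p i j) * c j)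
      ((2 : ℝ) • ∑ j, c j • A i j • ContinuousLinearMap.proj (R := ℝ) (φ := fun _ => ℝ) j) x := by
    refine HasFDerivAt.const_mul (HasFDerivAt.fun_sum fun j _ => ?_) 2
    exact (((hasFDerivAt_apply j x).sub_const _).const_mul (A i j)).mul_const (c j)
  have h4 := DFunLike.congr_fun (h2.unique (h3.congr_of_eventuallyEq
    (Filter.Eventually.of_forall fun y => fderiv_genDistSq p A y c i))) v
  simp only [ContinuousLinearMap.comp_apply, ContinuousLinearMap.proj_apply, add_apply,
    ContinuousLinearMap.flip_apply, zero_apply, map_zero, zero_add, smul_apply, sum_apply,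
    smul_eq_mul] at h4
  rw [h4]
  congr 1
  exact Finset.sum_congr rfl fun j _ => by ring

theorem hasDegenerateSingularity_genDistSq {n k : ℕ} {p : Fin (k + 1) → Fin (n + 1) → ℝ}
    {A : Matrix (Fin (k + 1)) (Fin (n + 1)) ℝ} (x : Fin (n + 1) → ℝ) {c : Fin (n + 1) → ℝ}
    (hc : c ≠ 0) {w : Fin (k + 1) → ℝ} (hw : w ≠ 0)
    (hker : ∀ i, ∑ j, A i j * (x j - p i j) * c j = 0)
    (hcoker : ∀ j, ∑ i, w i * (A i j * (x j - p i j)) = 0)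
    (hhess : ∀ j, (∑ i, w i * A i j) * c j = 0) :
    HasDegenerateSingularity (genDistSq p A).1 := by
  refine ⟨x, c, hc, ?_, ∑ i, w i • ContinuousLinearMap.proj (R := ℝ) (φ := fun _ => ℝ) i,
    ?_, fun v => ?_, fun v => ?_⟩
  · ext i
    rw [fderiv_genDistSq, hker, mul_zero, Pi.zero_apply]
  · obtain ⟨i, hi⟩ := Function.ne_iff.1 hw
    intro h
    refine hi ?_
    simpa [Pi.single_apply] using DFunLike.congr_fun h (Pi.single i 1)
  · simp only [sum_apply, smul_apply, ContinuousLinearMap.proj_apply, smul_eq_mul,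
      fderiv_genDistSq, Finset.mul_sum]
    rw [Finset.sum_comm]
    refine Finset.sum_eq_zero fun j _ => ?_
    calc _ = 2 * v j * ∑ i, w i * (A i j * (x j - p i j)) := by
          rw [Finset.mul_sum]
          exact Finset.sum_congr rfl fun i _ => by ring
      _ = 0 := by rw [hcoker, mul_zero]
  · simp only [sum_apply, smul_apply, ContinuousLinearMap.proj_apply, smul_eq_mul,
      fderiv_fderiv_genDistSq, Finset.mul_sum]
    rw [Finset.sum_comm]
    refine Finset.sum_eq_zero fun j _ => ?_
    calc _ = 2 * v j * ((∑ i, w i * A i j) * c j) := by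
          rw [Finset.sum_mul, Finset.mul_sum]
          exact Finset.sum_congr rfl fun i _ => by ring
      _ = 0 := by rw [hhess, mul_zero]

/-- The case of the kernel vector `c = e₀ + e₁`.  The condition that `w` annihilates column `0` of the
differential is omitted, as that column is the negative of column `1`. -/
theorem hasDegenerateSingularity_genDistSq_of_two_columns {n k : ℕ}
    {p : Fin (k + 1) → Fin (n + 2) → ℝ} {A : Matrix (Fin (k + 1)) (Fin (n + 2)) ℝ}
    (x : Fin (n + 2) → ℝ) {w : Fin (k + 1) → ℝ} (hw : w ≠ 0)
    (hker : ∀ i, A i 0 * (x 0 - p i 0) + A i 1 * (x 1 - p i 1) = 0)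
    (hcoker : ∀ j : Fin (n + 1), ∑ i, w i * (A i j.succ * (x j.succ - p i j.succ)) = 0)
    (h0 : ∑ i, w i * A i 0 = 0) (h1 : ∑ i, w i * A i 1 = 0) :
    HasDegenerateSingularity (genDistSq p A).1 := by
  refine hasDegenerateSingularity_genDistSq x (c := Pi.single 0 1 + Pi.single 1 1) ?_ hw
    (fun i => ?_) (fun j => ?_) fun j => ?_
  · exact fun h => by simpa using congr_fun h 0
  · simpa [mul_add, Finset.sum_add_distrib, Pi.single_apply] using hker i
  · refine Fin.cases ?_ hcoker j
    calc ∑ i, w i * (A i 0 * (x 0 - p i 0)) =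
        -∑ i, w i * (A i 1 * (x 1 - p i 1)) := by
          rw [← Finset.sum_neg_distrib]
          exact Finset.sum_congr rfl fun i _ => by linear_combination w i * hker i
      _ = 0 := by rw [neg_eq_zero]; exact hcoker 0
  · rcases eq_or_ne j 0 with rfl | hj0
    · rw [h0, zero_mul]
    rcases eq_or_ne j 1 with rfl | hj1
    · rw [h1, zero_mul]
    simp [hj0, hj1]

theorem isOpen_fullRankMatrices (n : ℕ) : IsOpen (fullRankMatrices n) := by
  -- `A` has full column rank iff its Gram matrix is invertible.
  have hrank : ∀ A : Matrix (Fin (2 * n + 1)) (Fin (n + 1)) ℝ,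
      A.rank = n + 1 ↔ (A.transpose * A).det ≠ 0 := by
    intro A
    rw [← Matrix.rank_transpose_mul_self, ← isUnit_iff_ne_zero, ← Matrix.isUnit_iff_isUnit_det]
    refine ⟨fun h => ?_, fun h => by simpa using Matrix.rank_of_isUnit _ h⟩
    rw [← Matrix.mulVec_surjective_iff_isUnit]
    refine (LinearMap.range_eq_top (f := (A.transpose * A).mulVecLin)).1
      (Submodule.eq_top_of_finrank_eq ?_)
    simpa [Matrix.rank] using h
  have : fullRankMatrices n = (⋂ i, ⋂ j, {A | A i j ≠ 0}) ∩ {A | (A.transpose * A).det ≠ 0} := by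
    ext A
    simp [fullRankMatrices, hrank]
  rw [this]
  refine IsOpen.inter (isOpen_iInter_of_finite fun i => isOpen_iInter_of_finite fun j => ?_) ?_
  · exact isOpen_ne_fun (by fun_prop) continuous_const
  · exact isOpen_ne_fun (by fun_prop) continuous_const

/-- At least three columns.  The column `1` of `B(p)` is chosen so that the origin is a singular point
with kernel vector `e₀ + e₁`; a functional `w` then exists by counting equations. -/
theorem exists_continuousAt_hasDegenerateSingularity {n : ℕ}
    {A : Matrix (Fin (2 * (n + 2) + 1)) (Fin (n + 3)) ℝ} (hA : ∀ i j, A i j ≠ 0) :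
    ∃ (p₀ : Fin (2 * (n + 2) + 1) → Fin (n + 3) → ℝ) (B : (Fin (2 * (n + 2) + 1) →
      Fin (n + 3) → ℝ) → Matrix (Fin (2 * (n + 2) + 1)) (Fin (n + 3)) ℝ),
      ContinuousAt B p₀ ∧ B p₀ = A ∧
        ∀ᶠ p in 𝓝 p₀, HasDegenerateSingularity (genDistSq p (B p)).1 := by
  let p₀ : Fin (2 * (n + 2) + 1) → Fin (n + 3) → ℝ :=
    fun i j => if j = 1 then -(A i 0 / A i 1) else 1
  have hp₀ : ∀ i, p₀ i 1 ≠ 0 := fun i => by simpa [p₀] using ⟨hA i 0, hA i 1⟩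
  have hc : ∀ i j, Continuous fun p : Fin (2 * (n + 2) + 1) → Fin (n + 3) → ℝ => p i j :=
    continuous_apply_apply
  refine ⟨p₀,
    fun p => Matrix.of fun i j => if j = 1 then -(A i 0 * p i 0 / p i 1) else A i j, ?_, ?_, ?_⟩
  · refine continuousAt_pi.2 fun i => continuousAt_pi.2 fun j => ?_
    by_cases hj : j = 1
    · simp only [Matrix.of_apply, hj, if_true]
      exact ((continuousAt_const.mul (hc i 0).continuousAt).div (hc i 1).continuousAt
        (hp₀ i)).neg
    · simp only [Matrix.of_apply, hj, if_false]
      exact continuousAt_const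
  · ext i j
    by_cases hj : j = 1
    · subst hj
      have := hA i 0
      have := hA i 1
      simp [p₀]
      field_simp
    · simp [hj]
  · have hne : ∀ᶠ p in 𝓝 p₀, ∀ i, p i 1 ≠ 0 :=
      Filter.eventually_all.2 fun i =>
        (hc i 1).continuousAt.eventually_ne (hp₀ i)
    filter_upwards [hne] with p hp
    set B : Matrix (Fin (2 * (n + 2) + 1)) (Fin (n + 3)) ℝ :=
      Matrix.of fun i j => if j = 1 then -(A i 0 * p i 0 / p i 1) else A i j with hB
    let M : Matrix (Fin (n + 2) ⊕ Fin 2) (Fin (2 * (n + 2) + 1)) ℝ := Matrix.of fun s i =>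
      Sum.elim (fun j : Fin (n + 2) => B i j.succ * (0 - p i j.succ)) ![B i 0, B i 1] s
    obtain ⟨w, hwM, hw⟩ := (Submodule.ne_bot_iff _).1
      (M.mulVecLin.ker_ne_bot_of_finrank_lt (by simp; omega))
    have hM : ∀ s, ∑ i, w i * M s i = 0 := fun s => by
      simpa [Matrix.mulVec, dotProduct, mul_comm] using congr_fun (LinearMap.mem_ker.1 hwM) s
    refine hasDegenerateSingularity_genDistSq_of_two_columns (n := n + 1) 0 hw (fun i => ?_)
      (fun j => hM (Sum.inl j)) (hM (Sum.inr 0)) (hM (Sum.inr 1))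
    have := hp i
    simp [hB]
    field_simp
    ring

/-- Two columns.  The singular point is `x = (ξ, 0)`, and the column `1` of `B` is chosen so that `e₀ + e₁`
is a kernel vector there.  With `w i = η i / A i 0`, the conditions on `w` are `∑ η i = 0`,
`∑ η i p i 0 = 0`, solved by the cyclic differences `η` of the `p i 0`, and
`∑ η i (p i 0 - ξ) / p i 1 = 0`, which determines `ξ` as long as `D p = ∑ η i / p i 1` is non-zero. -/
theorem exists_continuousAt_hasDegenerateSingularity_plane
    {A : Matrix (Fin 3) (Fin 2) ℝ} (hA : ∀ i j, A i j ≠ 0)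
    (h01 : A 0 1 / A 0 0 ≠ A 1 1 / A 1 0) (h12 : A 1 1 / A 1 0 ≠ A 2 1 / A 2 0)
    (h20 : A 2 1 / A 2 0 ≠ A 0 1 / A 0 0) :
    ∃ (p₀ : Fin 3 → Fin 2 → ℝ) (B : (Fin 3 → Fin 2 → ℝ) → Matrix (Fin 3) (Fin 2) ℝ),
      ContinuousAt B p₀ ∧ B p₀ = A ∧
        ∀ᶠ p in 𝓝 p₀, HasDegenerateSingularity (genDistSq p (B p)).1 := by
  let r : Fin 3 → ℝ := fun i => A i 1 / A i 0
  have hr : ∀ i, r i ≠ 0 := fun i => div_ne_zero (hA i 1) (hA i 0)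
  obtain ⟨κ, hκ0, hκ⟩ : ∃ κ : ℝ, κ ≠ 0 ∧ ∀ i, r i + κ ≠ 0 := by
    have h : ∀ i, |r i| ≤ ∑ i, |r i| := fun i =>
      Finset.single_le_sum (f := fun i => |r i|) (fun i _ => abs_nonneg _) (Finset.mem_univ i)
    refine ⟨1 + ∑ i, |r i|, (add_pos_of_pos_of_nonneg one_pos
      (Finset.sum_nonneg fun i _ => abs_nonneg _)).ne', fun i => ?_⟩
    linarith [h i, neg_abs_le (r i)]
  let η : (Fin 3 → Fin 2 → ℝ) → Fin 3 → ℝ :=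
    fun p => ![p 1 0 - p 2 0, p 2 0 - p 0 0, p 0 0 - p 1 0]
  let D : (Fin 3 → Fin 2 → ℝ) → ℝ := fun p => ∑ i, η p i / p i 1
  let ξ : (Fin 3 → Fin 2 → ℝ) → ℝ := fun p => (∑ i, η p i * p i 0 / p i 1) / D p
  -- This `p₀` has `ξ p₀ = 0` and reproduces the ratios `r i`; the shift `κ` keeps `p₀ i 1` away from `0`
  -- and makes `D p₀` a non-zero multiple of the Vandermonde product of the `r i`.
  let p₀ : Fin 3 → Fin 2 → ℝ := fun i => ![r i + κ, -((r i + κ) / r i)]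
  have hp₀ : ∀ i, p₀ i 1 ≠ 0 := fun i => neg_ne_zero.2 (div_ne_zero (hκ i) (hr i))
  have hD₀ : D p₀ ≠ 0 := by
    have h : D p₀ = -κ * (r 0 - r 1) * (r 1 - r 2) * (r 2 - r 0) /
        ((r 0 + κ) * (r 1 + κ) * (r 2 + κ)) := by
      have := hr 0; have := hr 1; have := hr 2
      have := hκ 0; have := hκ 1; have := hκ 2
      simp [D, η, p₀, Fin.sum_univ_three]
      field_simp
      ring
    rw [h]
    refine div_ne_zero (mul_ne_zero (mul_ne_zero (mul_ne_zero (neg_ne_zero.2 hκ0)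
      (sub_ne_zero.2 h01)) (sub_ne_zero.2 h12)) (sub_ne_zero.2 h20))
      (mul_ne_zero (mul_ne_zero (hκ 0) (hκ 1)) (hκ 2))
  have hξ₀ : ξ p₀ = 0 := by
    have h : ∑ i, η p₀ i * p₀ i 0 / p₀ i 1 = 0 := by
      have := hr 0; have := hr 1; have := hr 2
      have := hκ 0; have := hκ 1; have := hκ 2
      simp [η, p₀, Fin.sum_univ_three]
      field_simp
      ring
    simp only [ξ, h, zero_div]
  have hc : ∀ i j, Continuous fun p : Fin 3 → Fin 2 → ℝ => p i j := continuous_apply_apply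
  have hη : ∀ i, Continuous fun p => η p i := by
    intro i
    fin_cases i <;> simp [η] <;> fun_prop
  have hDc : ContinuousAt D p₀ := tendsto_finsetSum _ fun i _ =>
    (hη i).continuousAt.div (hc i 1).continuousAt (hp₀ i)
  have hξc : ContinuousAt ξ p₀ := ContinuousAt.div (tendsto_finsetSum _ fun i _ =>
    ((hη i).continuousAt.mul (hc i 0).continuousAt).div (hc i 1).continuousAt (hp₀ i)) hDc hD₀
  refine ⟨p₀, fun p => Matrix.of fun i => ![A i 0, A i 0 * (ξ p - p i 0) / p i 1], ?_, ?_, ?_⟩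
  · refine continuousAt_pi.2 fun i => continuousAt_pi.2 fun j => ?_
    fin_cases j
    · exact continuousAt_const
    · exact ContinuousAt.div (continuousAt_const.mul (hξc.sub (hc i 0).continuousAt))
        (hc i 1).continuousAt (hp₀ i)
  · ext i j
    fin_cases j
    · rfl
    · have h1 := hκ i
      have h2 := hr i
      have h3 : A i 1 = A i 0 * r i := by simp only [r]; field_simp [hA i 0]
      simp [hξ₀, p₀, h3]
      field_simp
      ring
  · have hne : ∀ᶠ p in 𝓝 p₀, ∀ i, p i 1 ≠ 0 :=
      Filter.eventually_all.2 fun i =>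
        (hc i 1).continuousAt.eventually_ne (hp₀ i)
    filter_upwards [hne, hDc.eventually_ne hD₀] with p hp hD
    have hξ : ξ p * D p = ∑ i, η p i * p i 0 / p i 1 := div_mul_cancel₀ _ hD
    have ha : ∀ i, A i 0 ≠ 0 := fun i => hA i 0
    have hη0 : ∑ i, η p i = 0 := by simp [η, Fin.sum_univ_three]
    have hη1 : ∑ i, η p i * p i 0 = 0 := by simp [η, Fin.sum_univ_three]; ring
    refine hasDegenerateSingularity_genDistSq_of_two_columns (n := 0) (k := 2)
      ![ξ p, 0] (w := fun i => η p i / A i 0) ?_ (fun i => ?_) (fun j => ?_) ?_ ?_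
    · intro h
      refine hD (Finset.sum_eq_zero fun i _ => ?_)
      have := congr_fun h i
      rw [Pi.zero_apply, div_eq_zero_iff, or_iff_left (ha i)] at this
      rw [this, zero_div]
    · have := hp i
      simp
      field_simp
      ring
    · obtain rfl : j = 0 := Fin.fin_one_eq_zero j
      calc _ = ∑ i, (η p i * p i 0 - η p i * ξ p) := by
            refine Finset.sum_congr rfl fun i _ => ?_
            have := hp i
            have := ha i
            simp
            field_simp
            ring
        _ = 0 := by rw [Finset.sum_sub_distrib, ← Finset.sum_mul, hη0, hη1]; ring
    · calc _ = ∑ i, η p i := Finset.sum_congr rfl fun i _ => div_mul_cancel₀ _ (ha i)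
        _ = 0 := hη0
    · calc _ = ∑ i, (ξ p * (η p i / p i 1) - η p i * p i 0 / p i 1) := by
            refine Finset.sum_congr rfl fun i _ => ?_
            have := hp i
            have := ha i
            simp
            field_simp
        _ = 0 := by rw [Finset.sum_sub_distrib, ← Finset.mul_sum, ← hξ]; exact sub_self _

theorem exists_mem_ne_div_of_isOpen {O : Set (Matrix (Fin 3) (Fin 2) ℝ)} (hO : IsOpen O)
    {A : Matrix (Fin 3) (Fin 2) ℝ} (hAO : A ∈ O) (hA : ∀ i, A i 0 ≠ 0) :
    ∃ A' ∈ O, A' 0 1 / A' 0 0 ≠ A' 1 1 / A' 1 0 ∧ A' 1 1 / A' 1 0 ≠ A' 2 1 / A' 2 0 ∧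
      A' 2 1 / A' 2 0 ≠ A' 0 1 / A' 0 0 := by
  -- This perturbation adds `ε * i` to the ratio of row `i`.
  let P : ℝ → Matrix (Fin 3) (Fin 2) ℝ := fun ε =>
    Matrix.of fun i => ![A i 0, A i 1 + ε * (i : ℕ) * A i 0]
  have hP : Continuous P := by
    refine continuous_pi fun i => continuous_pi fun j => ?_
    fin_cases j <;> simp [P] <;> fun_prop
  have hP0 : P 0 = A := by
    ext i j
    fin_cases j <;> simp [P]
  have hPO : ∀ᶠ ε in 𝓝[≠] (0 : ℝ), P ε ∈ O := nhdsWithin_le_nhds <|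
    hP.continuousAt.eventually_mem (hO.mem_nhds (by rwa [hP0]))
  have hne : ∀ t : ℝ, ∀ᶠ ε in 𝓝[≠] (0 : ℝ), ε ≠ t := by
    intro t
    rcases eq_or_ne t 0 with rfl | ht
    · exact self_mem_nhdsWithin
    · exact nhdsWithin_le_nhds (eventually_ne_nhds ht.symm)
  have hr : ∀ ε i, P ε i 1 / P ε i 0 = A i 1 / A i 0 + ε * (i : ℕ) := fun ε i => by
    have := hA i
    simp [P]
    field_simp
  obtain ⟨ε, hεO, h1, h2, h3⟩ := (hPO.and ((hne (A 0 1 / A 0 0 - A 1 1 / A 1 0)).and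
    ((hne (A 1 1 / A 1 0 - A 2 1 / A 2 0)).and
      (hne ((A 0 1 / A 0 0 - A 2 1 / A 2 0) / 2))))).exists
  refine ⟨P ε, hεO, ?_, ?_, ?_⟩ <;> rw [hr, hr]
  · exact fun h => h1 (by simp at h; linarith)
  · exact fun h => h2 (by simp at h; linarith)
  · exact fun h => h3 (by simp at h; linarith)

/-- Matrices `B` with `genDistSq p B` unstable, for all `p` in a non-empty open set, exist in every
non-empty open set of admissible matrices, however small. -/
theorem exists_isOpen_forall_exists_not_isStable {n : ℕ} (hn : 1 ≤ n)
    {O : Set (Matrix (Fin (2 * n + 1)) (Fin (n + 1)) ℝ)} (hO : IsOpen O)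
    (hOn : (O ∩ fullRankMatrices n).Nonempty) :
    ∃ V : Set (Fin (2 * n + 1) → Fin (n + 1) → ℝ), IsOpen V ∧ V.Nonempty ∧
      ∀ p ∈ V, ∃ B ∈ O ∩ fullRankMatrices n, ¬ IsStable (genDistSq p B) := by
  have hO' := hO.inter (isOpen_fullRankMatrices n)
  obtain ⟨p₀, B, hB, hB₀, hdeg⟩ : ∃ (p₀ : Fin (2 * n + 1) → Fin (n + 1) → ℝ)
      (B : (Fin (2 * n + 1) → Fin (n + 1) → ℝ) → Matrix (Fin (2 * n + 1)) (Fin (n + 1)) ℝ),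
      ContinuousAt B p₀ ∧ B p₀ ∈ O ∩ fullRankMatrices n ∧
        ∀ᶠ p in 𝓝 p₀, HasDegenerateSingularity (genDistSq p (B p)).1 := by
    obtain ⟨A, hA⟩ := hOn
    obtain _ | _ | n := n
    · omega
    · obtain ⟨A', hA', h01, h12, h20⟩ := exists_mem_ne_div_of_isOpen hO' hA fun i => hA.2.1 i 0
      obtain ⟨p₀, B, hB, rfl, hdeg⟩ :=
        exists_continuousAt_hasDegenerateSingularity_plane hA'.2.1 h01 h12 h20
      exact ⟨p₀, B, hB, hA', hdeg⟩
    · obtain ⟨p₀, B, hB, rfl, hdeg⟩ := exists_continuousAt_hasDegenerateSingularity hA.2.1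
      exact ⟨p₀, B, hB, hA, hdeg⟩
  obtain ⟨V, hV, hVo, hpV⟩ := eventually_nhds_iff.1
    ((hB.eventually_mem (hO'.mem_nhds hB₀)).and hdeg)
  refine ⟨V, hVo, ⟨p₀, hpV⟩, fun p hp => ⟨B p, (hV p hp).1, ?_⟩⟩
  refine not_isStable_of_hasDegenerateSingularity ?_ (hV p hp).2
  simp
  ring

theorem proposition3 (n : ℕ) (hn : 1 ≤ n) (A : fullRankMatrices n) :
    ∃ U : Set (fullRankMatrices n), IsOpen U ∧ A ∈ U ∧
      ∃ V : Set (Fin (2 * n + 1) → Fin (n + 1) → ℝ), IsOpen V ∧ V.Nonempty ∧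
        ∀ p ∈ V, ∃ B ∈ U, ¬ IsStable (genDistSq p B.1) := by
  obtain ⟨V, hV, hVne, h⟩ :=
    exists_isOpen_forall_exists_not_isStable hn isOpen_univ ⟨A.1, trivial, A.2⟩
  -- Any neighbourhood of `A` may be taken here; the smaller ones contain such matrices by the same lemma.
  refine ⟨Set.univ, isOpen_univ, trivial, V, hV, hVne, fun p hp => ?_⟩
  obtain ⟨B, hB, hst⟩ := h p hp
  exact ⟨⟨B, hB.2⟩, trivial, hst⟩
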